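/- Let $\mathbb K$ be $\mathbb R$ or $\mathbb C$, and let $X$ and $Y$ be infinite-dimensional Banach spaces over $\mathbb K$ such that $X$ and its dual $X^*$ are both separable in their norm topologies. Suppose that $X$ is not quasireflexive, i.e. the canonical image of $X$ in its second dual $X^{**}$ does not have finite codimension. Then there exists an injective bounded linear operator $T\colon X\to Y$ such that the range $T^*(Y^*)$ of its adjoint $T^*\colon Y^*\to X^*$, $T^*g=g\circ T$, is not $w^*$-sequentially dense in $X^*$; that is, there is a $g\in X^*$ for which no sequence $(f_n)$ in $T^*(Y^*)$ satisfies $\lim_{n\to\infty}f_n(x)=g(x)$ for all $x\in X$. -/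

import Mathlib

open Filter Topology

set_option maxSynthPendingDepth 3

/-- A normed space `X` over `𝕜` is quasireflexive if (the canonical image of) `X` has finite
codimension in its second dual. -/
def IsQuasireflexive (𝕜 : Type*) [RCLike 𝕜] (X : Type*) [NormedAddCommGroup X]
    [NormedSpace 𝕜 X] : Prop :=
  FiniteDimensional 𝕜
    (StrongDual 𝕜 (StrongDual 𝕜 X) ⧸
      LinearMap.range (NormedSpace.inclusionInDoubleDual 𝕜 X).toLinearMap)

/-- A set `F` of functionals is w*-sequentially dense in `X*` if every `g ∈ X*` is the pointwise
limit on `X` of a sequence of elements of `F`. -/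
def IsWeakStarSeqDense {𝕜 : Type*} [RCLike 𝕜] {X : Type*} [NormedAddCommGroup X]
    [NormedSpace 𝕜 X] (F : Set (StrongDual 𝕜 X)) : Prop :=
  ∀ g : StrongDual 𝕜 X, ∃ f : ℕ → StrongDual 𝕜 X,
    (∀ n, f n ∈ F) ∧ ∀ x : X, Tendsto (fun n => f n x) atTop (𝓝 (g x))

/-- The adjoint (Banach space dual operator) `T* : Y* → X*`, `T* g = g ∘ T`. -/
def dualOperator {𝕜 : Type*} [RCLike 𝕜] {X Y : Type*}
    [NormedAddCommGroup X] [NormedSpace 𝕜 X] [NormedAddCommGroup Y] [NormedSpace 𝕜 Y]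
    (T : X →L[𝕜] Y) : StrongDual 𝕜 Y →L[𝕜] StrongDual 𝕜 X :=
  ContinuousLinearMap.precomp 𝕜 T

theorem dualOperator_apply {𝕜 : Type*} [RCLike 𝕜] {X Y : Type*}
    [NormedAddCommGroup X] [NormedSpace 𝕜 X] [NormedAddCommGroup Y] [NormedSpace 𝕜 Y]
    (T : X →L[𝕜] Y) (g : StrongDual 𝕜 Y) (x : X) : dualOperator T g x = g (T x) :=
  rfl

/-! Since `X` has infinite codimension in its bidual, there are `F n` in the bidual and `φ k` in the
third dual, biorthogonal, with every `φ k` zero on `X`. Let `K` be the annihilator in the dual of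
the elements `F n + x n`, where `‖x n‖ ≥ n (‖F n‖ + 1)`. `K` is not w*-sequentially dense: a
w*-convergent sequence in `K` is bounded and satisfies `f (x n) = -F n f`, so its limit is bounded
on the vectors `x n / (‖F n‖ + 1)`. These are unbounded in norm, so some functional is unbounded on
them. The `x n` can be chosen so that `K` is still total (`exists_total_annihilatorSeq`). A rapidly
convergent series of rank-one operators built on a dense sequence of `K` is then injective, and its
adjoint has range in `K`. -/

/-- Recursive construction of a sequence in which each term is chosen in terms of all earlier
ones. -/
theorem exists_seq_of_forall_prefix {α : Type*} [Nonempty α] (P : ℕ → (ℕ → α) → α → Prop)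
    (hP : ∀ n p, ∃ a, P n p a)
    (hcongr : ∀ n p q a, (∀ i < n, p i = q i) → P n p a → P n q a) :
    ∃ f : ℕ → α, ∀ n, P n f (f n) := by
  classical
  choose c hc using hP
  let d : α := Classical.arbitrary α
  let f : ℕ → α := fun n => Nat.strongRec (motive := fun _ => α)
    (fun n ih => c n (fun i => if h : i < n then ih i h else d)) n
  have hf : ∀ n, f n = c n (fun i => if i < n then f i else d) := by
    intro n
    change Nat.strongRec (motive := fun _ => α)
      (fun n ih => c n (fun i => if h : i < n then ih i h else d)) n = _
    rw [Nat.strongRec_eq]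
    congr 1
  refine ⟨f, fun n => ?_⟩
  have := hc n (fun i => if i < n then f i else d)
  rw [← hf n] at this
  exact hcongr n _ _ _ (fun i hi => by simp [hi]) this

/-! ### Helly's theorem and biorthogonal systems -/

section

variable {𝕜 : Type*} [RCLike 𝕜]

/-- **Helly's theorem**: on finitely many functionals, an element of the bidual is represented by
a vector of almost the same norm. -/
theorem exists_norm_lt_forall_apply_eq {V : Type*} [NormedAddCommGroup V] [NormedSpace 𝕜 V]
    {ι : Type*} [Finite ι] (f : ι → StrongDual 𝕜 V) (F : StrongDual 𝕜 (StrongDual 𝕜 V))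
    {ε : ℝ} (hε : 0 < ε) : ∃ v : V, ‖v‖ < ‖F‖ + ε ∧ ∀ i, f i v = F (f i) := by
  classical
  have := Fintype.ofFinite ι
  let L : V →ₗ[𝕜] (ι → 𝕜) := LinearMap.pi fun i => (f i : V →ₗ[𝕜] 𝕜)
  have hL : (fun i => F (f i)) ∈ LinearMap.range L := by
    by_contra hy
    obtain ⟨c, hc, hcL⟩ := Submodule.exists_le_ker_of_notMem hy
    apply hc
    rw [LinearMap.pi_apply_eq_sum_univ c]
    have hsum : ∑ i, c (fun j => if i = j then 1 else 0) • f i = 0 := by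
      ext v
      have h0 : c (L v) = 0 := hcL ⟨v, rfl⟩
      rw [LinearMap.pi_apply_eq_sum_univ c] at h0
      simpa [L, mul_comm] using h0
    have := congrArg F hsum
    simpa [mul_comm] using this
  obtain ⟨v₀, hv₀⟩ := hL
  have hv₀' : ∀ i, f i v₀ = F (f i) := fun i => congrFun hv₀ i
  let W : Submodule 𝕜 V := ⨅ i, LinearMap.ker (f i : V →ₗ[𝕜] 𝕜)
  -- A functional norming the class of `v₀` modulo `W` pulls back to a combination of the `f i`,
  -- where `F` is evaluation at `v₀`; hence that class has norm at most `‖F‖`.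
  obtain ⟨g, hg1, hg⟩ := exists_dual_vector'' 𝕜 (Submodule.Quotient.mk v₀ : V ⧸ W)
  let g' : StrongDual 𝕜 V := LinearMap.mkContinuous (g.toLinearMap ∘ₗ W.mkQ) 1 fun v => by
    refine (g.le_opNorm _).trans ?_
    gcongr
    exact Submodule.Quotient.norm_mk_le W v
  have hspan : (g' : V →ₗ[𝕜] 𝕜) ∈
      Submodule.span 𝕜 (Set.range fun i => (f i : V →ₗ[𝕜] 𝕜)) := by
    refine mem_span_of_iInf_ker_le_ker fun v hv => ?_
    change g (Submodule.Quotient.mk v) = 0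
    rw [(Submodule.Quotient.mk_eq_zero W).2 hv, map_zero]
  obtain ⟨c, hc⟩ := (Submodule.mem_span_range_iff_exists_fun 𝕜).1 hspan
  have hg' : g' = ∑ i, c i • f i := by
    ext v
    simpa using (LinearMap.congr_fun hc v).symm
  have hnorm : F g' = ((‖(Submodule.Quotient.mk v₀ : V ⧸ W)‖ : ℝ) : 𝕜) := by
    rw [← hg]
    change F g' = g' v₀
    rw [hg']
    simp [hv₀']
  have hle : ‖(Submodule.Quotient.mk v₀ : V ⧸ W)‖ ≤ ‖F‖ := by
    have h1 := F.le_opNorm g'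
    rw [hnorm, RCLike.norm_ofReal, abs_of_nonneg (norm_nonneg _)] at h1
    have h2 : ‖g'‖ ≤ 1 := LinearMap.mkContinuous_norm_le _ zero_le_one _
    nlinarith [norm_nonneg F]
  obtain ⟨v, hv, hvn⟩ := Submodule.Quotient.norm_mk_lt
    (Submodule.Quotient.mk v₀ : V ⧸ W) hε
  refine ⟨v, by linarith, fun i => ?_⟩
  have hmem : v - v₀ ∈ W := (Submodule.Quotient.eq W).1 hv
  have h3 := (Submodule.mem_iInf _).1 hmem i
  rw [← hv₀' i, ← sub_eq_zero, ← map_sub]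
  exact h3

/-- Finitely many functionals on an infinite-dimensional space have a common zero outside any
given finite-dimensional subspace. -/
theorem exists_notMem_forall_apply_eq_zero {V : Type*} [AddCommGroup V] [Module 𝕜 V]
    (hV : ¬ FiniteDimensional 𝕜 V) {ι : Type*} [Finite ι] (f : ι → V →ₗ[𝕜] 𝕜)
    (S : Submodule 𝕜 V) [FiniteDimensional 𝕜 S] : ∃ v, v ∉ S ∧ ∀ i, f i v = 0 := by
  by_contra! h
  apply hV
  have hker : LinearMap.ker (LinearMap.pi f) ≤ S := by
    intro v hv
    by_contra hvS
    obtain ⟨i, hi⟩ := h v hvS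
    exact hi (congrFun hv i)
  have : FiniteDimensional 𝕜 (LinearMap.ker (LinearMap.pi f)) :=
    Submodule.finiteDimensional_of_le hker
  have h1 : (LinearMap.ker (LinearMap.pi f)).FG := Module.Finite.iff_fg.1 inferInstance
  have h2 : (Submodule.map (LinearMap.pi f) ⊤).FG := IsNoetherian.noetherian _
  exact ⟨Submodule.fg_of_fg_map_of_fg_inf_ker (LinearMap.pi f) h2 (by simpa using h1)⟩

/-- Every infinite-dimensional normed space has an infinite biorthogonal system. -/
theorem exists_biorthogonal_seq {V : Type*} [NormedAddCommGroup V] [NormedSpace 𝕜 V]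
    (hV : ¬ FiniteDimensional 𝕜 V) :
    ∃ (v : ℕ → V) (φ : ℕ → StrongDual 𝕜 V), ∀ i k, φ k (v i) = if i = k then 1 else 0 := by
  classical
  obtain ⟨f, hf1, hf2⟩ := exists_seq_of_forall_finset_exists
    (α := V × StrongDual 𝕜 V) (fun p => p.2 p.1 = 1) (fun p q => p.2 q.1 = 0 ∧ q.2 p.1 = 0) (by
      intro s hs
      let S : Submodule 𝕜 V := Submodule.span 𝕜 (Prod.fst '' (s : Set (V × StrongDual 𝕜 V)))
      have : FiniteDimensional 𝕜 S :=
        FiniteDimensional.span_of_finite 𝕜 (s.finite_toSet.image _)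
      obtain ⟨w, hwS, hw⟩ := exists_notMem_forall_apply_eq_zero hV
        (fun p : s => (p.1.2 : V →ₗ[𝕜] 𝕜)) S
      have hcl : IsClosed (S : Set V) := S.closed_of_finiteDimensional
      have : IsClosed (S.toAddSubgroup : Set V) := hcl
      have hne : ‖(Submodule.Quotient.mk w : V ⧸ S)‖ ≠ 0 := by
        intro h0
        have := (QuotientAddGroup.norm_mk_eq_zero (S := S.toAddSubgroup) (m := w)).1 h0
        exact hwS this
      obtain ⟨g, hg1, hg⟩ := exists_dual_vector 𝕜 _ hne
      let g' : StrongDual 𝕜 V := LinearMap.mkContinuous (g.toLinearMap ∘ₗ S.mkQ) 1 fun v => by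
        refine (g.le_opNorm _).trans ?_
        gcongr
        · exact hg1.le
        · exact Submodule.Quotient.norm_mk_le S v
      have hg'w : g' w = ((‖(Submodule.Quotient.mk w : V ⧸ S)‖ : ℝ) : 𝕜) := hg
      have hg'S : ∀ v ∈ S, g' v = 0 := by
        intro v hv
        change g (Submodule.Quotient.mk v) = 0
        rw [(Submodule.Quotient.mk_eq_zero S).2 hv, map_zero]
      have hne' : g' w ≠ 0 := by
        rw [hg'w]
        exact_mod_cast hne
      refine ⟨(w, (g' w)⁻¹ • g'), ?_, fun p hp => ⟨hw ⟨p, hp⟩, ?_⟩⟩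
      · simp [hne']
      · have := hg'S p.1 (Submodule.subset_span ⟨p, hp, rfl⟩)
        simp [this])
  refine ⟨fun n => (f n).1, fun n => (f n).2, fun i k => ?_⟩
  rcases lt_trichotomy i k with h | rfl | h
  · simpa [h.ne] using (hf2 i k h).2
  · simpa using hf1 i
  · simpa [h.ne'] using (hf2 k i h).1

end

/-! ### The total annihilator -/

section

variable {𝕜 : Type*} [RCLike 𝕜]

open NormedSpace

/-- If `V ⧸ S` is infinite-dimensional and `S` is closed, there is a biorthogonal sequence in `V`
whose functionals vanish on `S`. -/
theorem exists_biorthogonal_seq_of_quotient {V : Type*} [NormedAddCommGroup V] [NormedSpace 𝕜 V]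
    (S : Submodule 𝕜 V) (hS : IsClosed (S : Set V)) (hV : ¬ FiniteDimensional 𝕜 (V ⧸ S)) :
    ∃ (v : ℕ → V) (φ : ℕ → StrongDual 𝕜 V),
      (∀ i k, φ k (v i) = if i = k then 1 else 0) ∧ ∀ k, ∀ s ∈ S, φ k s = 0 := by
  have := hS
  obtain ⟨w, ψ, h⟩ := exists_biorthogonal_seq (𝕜 := 𝕜) hV
  choose v hv using fun i => Submodule.Quotient.mk_surjective S (w i)
  refine ⟨v, fun k => LinearMap.mkContinuous ((ψ k).toLinearMap ∘ₗ S.mkQ) ‖ψ k‖ fun x => ?_,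
    fun i k => ?_, fun k s hs => ?_⟩
  · refine ((ψ k).le_opNorm _).trans ?_
    gcongr
    exact Submodule.Quotient.norm_mk_le S x
  · change ψ k (Submodule.Quotient.mk (v i)) = _
    rw [hv, h]
  · change ψ k (Submodule.Quotient.mk s) = 0
    rw [(Submodule.Quotient.mk_eq_zero S).2 hs, map_zero]

/-- One can choose a vector of arbitrarily large norm on which finitely many functionals take the
values prescribed by an element of the bidual. -/
theorem exists_le_norm_forall_apply_eq {X : Type*} [NormedAddCommGroup X] [NormedSpace 𝕜 X]
    (hX : ¬ FiniteDimensional 𝕜 X) {ι : Type*} [Finite ι] (f : ι → StrongDual 𝕜 X)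
    (F : StrongDual 𝕜 (StrongDual 𝕜 X)) (R : ℝ) :
    ∃ x : X, R ≤ ‖x‖ ∧ ∀ i, f i x = F (f i) := by
  obtain ⟨u, -, hu⟩ := exists_norm_lt_forall_apply_eq f F one_pos
  obtain ⟨v, hv0, hv⟩ := exists_notMem_forall_apply_eq_zero hX
    (fun i => (f i : X →ₗ[𝕜] 𝕜)) ⊥
  have hv0' : ‖v‖ ≠ 0 := by simpa using hv0
  obtain ⟨t, ht⟩ : ∃ t : ℝ, t * ‖v‖ = |R| + ‖u‖ := ⟨(|R| + ‖u‖) / ‖v‖, by field_simp⟩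
  refine ⟨u + (t : 𝕜) • v, ?_, fun i => ?_⟩
  · have h1 : ‖(t : 𝕜) • v‖ ≤ ‖u + (t : 𝕜) • v‖ + ‖u‖ := by
      calc ‖(t : 𝕜) • v‖ = ‖(u + (t : 𝕜) • v) - u‖ := by rw [add_sub_cancel_left]
        _ ≤ _ := norm_sub_le _ _
    have h2 : |R| + ‖u‖ ≤ ‖(t : 𝕜) • v‖ := by
      rw [norm_smul, RCLike.norm_ofReal, ← ht]
      gcongr
      exact le_abs_self t
    linarith [le_abs_self R]
  · have : f i v = 0 := hv i
    simp [hu, this]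

/-- The annihilator in the dual of a sequence of bidual elements `F n + x n`. -/
def annihilatorSeq {X : Type*} [NormedAddCommGroup X] [NormedSpace 𝕜 X]
    (F : ℕ → StrongDual 𝕜 (StrongDual 𝕜 X)) (x : ℕ → X) : Submodule 𝕜 (StrongDual 𝕜 X) where
  carrier := {f | ∀ n, F n f + f (x n) = 0}
  add_mem' {f g} hf hg n := by
    have h1 := hf n
    have h2 := hg n
    simp only [map_add, add_apply]
    linear_combination h1 + h2
  zero_mem' n := by simp
  smul_mem' c f hf n := by
    have h1 := hf n
    simp only [map_smul, smul_apply, smul_eq_mul]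
    linear_combination c * h1

theorem mem_annihilatorSeq {X : Type*} [NormedAddCommGroup X] [NormedSpace 𝕜 X]
    {F : ℕ → StrongDual 𝕜 (StrongDual 𝕜 X)} {x : ℕ → X} {f : StrongDual 𝕜 X} :
    f ∈ annihilatorSeq F x ↔ ∀ n, F n f + f (x n) = 0 :=
  Iff.rfl

/-- A non-quasireflexive Banach space with separable dual has a total subspace of its dual which
is the annihilator of bidual elements `F n + x n` with `x n` much larger than `F n`. -/
theorem exists_total_annihilatorSeq {X : Type*} [NormedAddCommGroup X] [NormedSpace 𝕜 X]
    [CompleteSpace X] [TopologicalSpace.SeparableSpace X]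
    [TopologicalSpace.SeparableSpace (StrongDual 𝕜 X)]
    (hX : ¬ FiniteDimensional 𝕜 X) (hXqr : ¬ IsQuasireflexive 𝕜 X) :
    ∃ (F : ℕ → StrongDual 𝕜 (StrongDual 𝕜 X)) (x : ℕ → X),
      (∀ n : ℕ, n * (‖F n‖ + 1) ≤ ‖x n‖) ∧
      ∀ y : X, (∀ f ∈ annihilatorSeq F x, f y = 0) → y = 0 := by
  classical
  obtain ⟨F, φ, hφ, hφX⟩ := exists_biorthogonal_seq_of_quotient (𝕜 := 𝕜)
    (V := StrongDual 𝕜 (StrongDual 𝕜 X))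
    (LinearMap.range (inclusionInDoubleDual 𝕜 X).toLinearMap)
    (by
      have h := (inclusionInDoubleDualLi (E := X) 𝕜).isometry.isClosedEmbedding.isClosed_range
      convert h using 1
      exact LinearMap.coe_range _) hXqr
  have hφX' : ∀ k y, φ k (inclusionInDoubleDual 𝕜 X y) = 0 := fun k y => hφX k _ ⟨y, rfl⟩
  let z := TopologicalSpace.denseSeq X
  let g := TopologicalSpace.denseSeq (StrongDual 𝕜 X)
  -- Stage `N` picks `x N` and Helly approximations `h k N` of `φ k`, of norm bounded in `N`. They
  -- agree with `φ k` at `F i + x i` for `i ≤ N` and vanish at `z j` for `j < N`. `F N + x N` kills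
  -- the earlier `g i` and `h k n` with `k ≤ n`, so biorthogonality persists.
  obtain ⟨p, hp⟩ := exists_seq_of_forall_prefix
    (α := X × (ℕ → StrongDual 𝕜 X))
    (fun N p a => N * (‖F N‖ + 1) ≤ ‖a.1‖ ∧ (∀ i < N, F N (g i) + g i a.1 = 0) ∧
      (∀ n < N, ∀ k ≤ n, F N ((p n).2 k) + (p n).2 k a.1 = 0) ∧
      (∀ k, ‖a.2 k‖ < ‖φ k‖ + 1) ∧
      (∀ k, ∀ i < N, F i (a.2 k) + a.2 k (p i).1 = if i = k then 1 else 0) ∧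
      (∀ k, F N (a.2 k) + a.2 k a.1 = if N = k then 1 else 0) ∧
      ∀ k, ∀ j < N, a.2 k (z j) = 0)
    (by
      intro N p
      obtain ⟨x, hx, hxF⟩ := exists_le_norm_forall_apply_eq hX
        (Sum.elim (fun i : Fin N => g i) fun q : Fin N × Fin N => (p q.1).2 q.2) (-F N)
        (N * (‖F N‖ + 1))
      choose h hh hhφ using fun k => exists_norm_lt_forall_apply_eq
        (Sum.elim (fun i : Fin N => F i + inclusionInDoubleDual 𝕜 X (p i).1)
          (Sum.elim (fun j : Fin N => inclusionInDoubleDual 𝕜 X (z j))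
            fun _ : Unit => F N + inclusionInDoubleDual 𝕜 X x)) (φ k) one_pos
      refine ⟨(x, h), hx, fun i hi => ?_, fun n hn k hk => ?_, hh, fun k i hi => ?_,
        fun k => ?_, fun k j hj => ?_⟩
      · simp [show g i x = _ from hxF (Sum.inl ⟨i, hi⟩)]
      · simp [show (p n).2 k x = _ from hxF (Sum.inr (⟨n, hn⟩, ⟨k, by omega⟩))]
      · simpa [hφX', hφ] using hhφ k (Sum.inl ⟨i, hi⟩)
      · simpa [hφX', hφ] using hhφ k (Sum.inr (Sum.inr ()))
      · simpa [hφX', hφ] using hhφ k (Sum.inr (Sum.inl ⟨j, hj⟩)))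
    (by
      rintro N p q a hpq ⟨h1, h2, h3, h4, h5, h6, h7⟩
      refine ⟨h1, h2, fun n hn => ?_, h4, fun k i hi => ?_, h6, h7⟩
      · rw [← hpq n hn]
        exact h3 n hn
      · rw [← hpq i hi]
        exact h5 k i hi)
  choose hx hg hh hnorm hlt hdiag hz using hp
  let x : ℕ → X := fun n => (p n).1
  let h : ℕ → ℕ → StrongDual 𝕜 X := fun k n => (p n).2 k
  have hbi : ∀ k n, k ≤ n → ∀ i, F i (h k n) + h k n (x i) = if i = k then 1 else 0 := by
    intro k n hkn i
    rcases lt_trichotomy i n with hi | rfl | hi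
    · exact hlt n k i hi
    · exact hdiag i k
    · rw [if_neg (by omega)]
      exact hh i n hi k hkn
  refine ⟨F, x, hx, fun y hy => ?_⟩
  -- For fixed `k` the `h k n` are bounded and eventually vanish at each `z j`, hence are w*-null.
  have hlim : ∀ k, Tendsto (fun n => h k n y) atTop (𝓝 0) := by
    intro k
    rw [Metric.tendsto_atTop]
    intro ε hε
    have hC : 0 < ‖φ k‖ + 1 := by positivity
    obtain ⟨j, hj⟩ := (TopologicalSpace.denseRange_denseSeq X).exists_dist_lt y
      (div_pos hε hC)
    refine ⟨j + 1, fun n hn => ?_⟩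
    have h1 : h k n (z j) = 0 := hz n k j (by omega)
    rw [dist_zero_right, ← sub_zero (h k n y), ← h1, ← map_sub]
    calc ‖h k n (y - z j)‖ ≤ ‖h k n‖ * ‖y - z j‖ := (h k n).le_opNorm _
      _ ≤ (‖φ k‖ + 1) * ‖y - z j‖ := by
        gcongr
        exact (hnorm n k).le
      _ < (‖φ k‖ + 1) * (ε / (‖φ k‖ + 1)) := by
        gcongr
        rwa [← dist_eq_norm]
      _ = ε := by field_simp
  have hzero : ∀ k, h k k y = 0 := by
    intro k
    refine tendsto_nhds_unique ?_ (hlim k)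
    refine tendsto_const_nhds.congr' ?_
    filter_upwards [eventually_ge_atTop k] with n hn
    have hmem : h k k - h k n ∈ annihilatorSeq F x := fun i => by
      have h1 := hbi k k le_rfl i
      have h2 := hbi k n hn i
      simp only [map_sub, sub_apply]
      linear_combination h1 - h2
    exact sub_eq_zero.1 (hy _ hmem)
  have hgy : ∀ n, g n y = 0 := by
    intro n
    -- Only the `F i + x i` with `i ≤ n` can be nonzero at `g n`; subtracting multiples of the `h k
    -- k` corrects those values.
    have hmem : g n - ∑ k ∈ Finset.range (n + 1), (F k (g n) + g n (x k)) • h k k ∈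
        annihilatorSeq F x := fun i => by
      have hsum : F i (∑ k ∈ Finset.range (n + 1), (F k (g n) + g n (x k)) • h k k) +
          (∑ k ∈ Finset.range (n + 1), (F k (g n) + g n (x k)) • h k k) (x i) =
          if i ∈ Finset.range (n + 1) then F i (g n) + g n (x i) else 0 := by
        rw [map_sum, sum_apply, ← Finset.sum_add_distrib,
          ← Finset.sum_ite_eq (Finset.range (n + 1)) i (fun k => F k (g n) + g n (x k))]
        refine Finset.sum_congr rfl fun k _ => ?_
        have h1 := hbi k k le_rfl i
        simp only [map_smul, smul_apply, smul_eq_mul, ← mul_add, h1]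
        simp
      have h0 : i ∉ Finset.range (n + 1) → F i (g n) + g n (x i) = 0 := fun hi =>
        hg i n (by simpa using hi)
      simp only [map_sub, sub_apply]
      split_ifs at hsum with hi
      · linear_combination -hsum
      · linear_combination h0 hi - hsum
    have := hy _ hmem
    simpa [sum_apply, hzero] using this
  have hall : ∀ f : StrongDual 𝕜 X, f y = 0 := by
    intro f
    have hcl : IsClosed {f : StrongDual 𝕜 X | f y = 0} :=
      isClosed_eq (by fun_prop) continuous_const
    have hd := (TopologicalSpace.denseRange_denseSeq (StrongDual 𝕜 X))
    exact hcl.closure_subset_iff.2 (Set.range_subset_iff.2 hgy) (hd f)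
  exact SeparatingDual.eq_zero_of_forall_dual_eq_zero hall

end

/-! ### The operator and the failure of sequential density -/

section

variable {𝕜 : Type*} [RCLike 𝕜]

/-- A total sequence of functionals on `X` is turned into an injective operator to any
infinite-dimensional Banach space whose adjoint has its range in the closed linear span of the
sequence. -/
theorem exists_injective_range_dualOperator_subset {X Y : Type*}
    [NormedAddCommGroup X] [NormedSpace 𝕜 X]
    [NormedAddCommGroup Y] [NormedSpace 𝕜 Y] [CompleteSpace Y]
    (hY : ¬ FiniteDimensional 𝕜 Y) (f : ℕ → StrongDual 𝕜 X)
    (hf : ∀ x, (∀ n, f n x = 0) → x = 0) :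
    ∃ T : X →L[𝕜] Y, Function.Injective T ∧ ∀ G : StrongDual 𝕜 (StrongDual 𝕜 X),
      (∀ n, G (f n) = 0) → ∀ g : StrongDual 𝕜 Y, G (dualOperator T g) = 0 := by
  obtain ⟨y, η, hη⟩ := exists_biorthogonal_seq (𝕜 := 𝕜) hY
  let a : ℕ → ℝ := fun n => (1 / 2) ^ n / ((‖f n‖ + 1) * (‖y n‖ + 1))
  have ha : ∀ n, 0 < a n := fun n => by positivity
  let t : ℕ → X →L[𝕜] Y := fun n => (a n : 𝕜) • (f n).smulRight (y n)
  have ht : Summable t := by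
    refine Summable.of_norm_bounded (summable_geometric_two) fun n => ?_
    rw [norm_smul, ContinuousLinearMap.norm_smulRight_apply, RCLike.norm_ofReal,
      abs_of_pos (ha n), div_mul_eq_mul_div, div_le_iff₀ (by positivity)]
    gcongr <;> linarith
  have hdual : ∀ g : StrongDual 𝕜 Y, HasSum (fun n => (a n * g (y n)) • f n)
      (dualOperator (∑' n, t n) g) := by
    intro g
    have h1 := (ContinuousLinearMap.compL 𝕜 X Y 𝕜 g).hasSum ht.hasSum
    have h2 : ∀ n, ContinuousLinearMap.compL 𝕜 X Y 𝕜 g (t n) = (a n * g (y n)) • f n := fun n => by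
      ext x
      simp [t, RCLike.real_smul_eq_coe_mul]
      ring
    simp only [h2] at h1
    exact h1
  refine ⟨∑' n, t n, ?_, fun G hG g => ?_⟩
  · rw [injective_iff_map_eq_zero]
    intro x hx
    refine hf x fun m => ?_
    -- Testing against `η m` isolates the `m`-th term of the series.
    have h1 := (ContinuousLinearMap.apply 𝕜 𝕜 x).hasSum (hdual (η m))
    have h2 : HasSum (fun n => (a n * η m (y n) * f n x : 𝕜)) (a m * η m (y m) * f m x) :=
      hasSum_single m fun n hn => by simp [hη, hn]
    have h3 : dualOperator (∑' n, t n) (η m) x = a m * η m (y m) * f m x :=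
      HasSum.unique h1 h2
    rw [dualOperator_apply, hx, map_zero] at h3
    simpa [hη, (ha m).ne'] using h3.symm
  · have h1 := G.hasSum (hdual g)
    have h2 : HasSum (fun _ : ℕ => (0 : 𝕜)) (G (dualOperator (∑' n, t n) g)) :=
      by simpa [hG] using h1
    exact h2.unique hasSum_zero

/-- The annihilator of `F n + x n`, with `x n` much larger than `F n`, contains no
w*-sequentially dense set. -/
theorem not_isWeakStarSeqDense_of_subset_annihilatorSeq {X : Type*}
    [NormedAddCommGroup X] [NormedSpace 𝕜 X] [CompleteSpace X]
    {F : ℕ → StrongDual 𝕜 (StrongDual 𝕜 X)} {x : ℕ → X}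
    (hx : ∀ n : ℕ, n * (‖F n‖ + 1) ≤ ‖x n‖) {D : Set (StrongDual 𝕜 X)}
    (hD : D ⊆ annihilatorSeq F x) : ¬ IsWeakStarSeqDense D := by
  intro hdense
  let u : ℕ → X := fun n => (((‖F n‖ + 1)⁻¹ : ℝ) : 𝕜) • x n
  have hF : ∀ n, 0 < ‖F n‖ + 1 := fun n => by positivity
  have hu : ∀ n, ‖u n‖ = (‖F n‖ + 1)⁻¹ * ‖x n‖ := fun n => by
    rw [norm_smul, RCLike.norm_ofReal, abs_of_pos (inv_pos.2 (hF n))]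
  obtain ⟨C, hC⟩ := banach_steinhaus
    (g := fun n => NormedSpace.inclusionInDoubleDualLi (E := X) 𝕜 (u n)) (by
      intro g
      obtain ⟨f, hfD, hfg⟩ := hdense g
      obtain ⟨C, hC⟩ := banach_steinhaus (g := f) fun y => by
        obtain ⟨C, hC⟩ := (hfg y).norm.bddAbove_range
        exact ⟨C, fun i => hC ⟨i, rfl⟩⟩
      have hC0 : 0 ≤ C := (norm_nonneg _).trans (hC 0)
      refine ⟨C, fun n => ?_⟩
      change ‖g (u n)‖ ≤ C
      refine le_of_tendsto (hfg (u n)).norm (Eventually.of_forall fun m => ?_)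
      have h1 : f m (x n) = -F n (f m) := by
        linear_combination (mem_annihilatorSeq.1 (hD (hfD m))) n
      rw [map_smul, norm_smul, RCLike.norm_ofReal, abs_of_pos (inv_pos.2 (hF n)), h1, norm_neg,
        inv_mul_le_iff₀ (hF n)]
      calc ‖F n (f m)‖ ≤ ‖F n‖ * ‖f m‖ := (F n).le_opNorm _
        _ ≤ (‖F n‖ + 1) * C := by
          gcongr
          · linarith
          · exact hC m)
  obtain ⟨n, hn⟩ := exists_nat_gt C
  have h1 := hC n
  rw [LinearIsometry.norm_map, hu, inv_mul_le_iff₀ (hF n)] at h1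
  nlinarith [hx n, hF n]

end

theorem corollary3p1 {𝕜 : Type*} [RCLike 𝕜] {X Y : Type*}
    [NormedAddCommGroup X] [NormedSpace 𝕜 X] [CompleteSpace X]
    [NormedAddCommGroup Y] [NormedSpace 𝕜 Y] [CompleteSpace Y]
    (hXinf : ¬ FiniteDimensional 𝕜 X) (hYinf : ¬ FiniteDimensional 𝕜 Y)
    (hXsep : TopologicalSpace.SeparableSpace X)
    (hXdual : TopologicalSpace.SeparableSpace (StrongDual 𝕜 X))
    (hXqr : ¬ IsQuasireflexive 𝕜 X) :
    ∃ T : X →L[𝕜] Y, Function.Injective T ∧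
      ¬ IsWeakStarSeqDense (Set.range (dualOperator T)) := by
  obtain ⟨F, x, hx, htotal⟩ := exists_total_annihilatorSeq hXinf hXqr
  have : SecondCountableTopology (StrongDual 𝕜 X) :=
    UniformSpace.secondCountable_of_separable _
  let f := TopologicalSpace.denseSeq (annihilatorSeq F x)
  obtain ⟨T, hT, hTG⟩ := exists_injective_range_dualOperator_subset hYinf
    (fun n => (f n : StrongDual 𝕜 X)) (by
      intro y hy
      refine htotal y fun h hh => ?_
      have hcl : IsClosed {k : annihilatorSeq F x | (k : StrongDual 𝕜 X) y = 0} :=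
        isClosed_eq (((ContinuousLinearMap.apply 𝕜 𝕜 y).continuous).comp
          continuous_subtype_val) continuous_const
      exact hcl.closure_subset_iff.2 (Set.range_subset_iff.2 hy)
        (TopologicalSpace.denseRange_denseSeq (annihilatorSeq F x) ⟨h, hh⟩))
  refine ⟨T, hT, not_isWeakStarSeqDense_of_subset_annihilatorSeq hx ?_⟩
  rintro _ ⟨g, rfl⟩
  exact fun n => hTG (F n + NormedSpace.inclusionInDoubleDual 𝕜 X (x n))
    (fun m => mem_annihilatorSeq.1 (f m).2 n) g
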